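/- **Theorem 2.1 (Magic formula for Jacobi matrices).** A two-sided Jacobi matrix $J$ is given by uniformly bounded real sequences $\{a_n,b_n\}_{n\in\mathbb Z}$ with $a_n>0$ for all $n$, and acts as a bounded operator on $\ell^2(\mathbb Z)$ by $$(Ju)_n=a_nu_{n+1}+b_nu_n+a_{n-1}u_{n-1}.$$ For an integer $p\ge 1$, $J$ is called $p$-periodic if $a_{n+p}=a_n$ and $b_{n+p}=b_n$ for all $n\in\mathbb Z$. Let $J_0$ be a $p$-periodic two-sided Jacobi matrix with parameters $\{a_n^{(0)},b_n^{(0)}\}_{n\in\mathbb Z}$. Its discriminant is the real polynomial $$\Delta_{J_0}(x)=\operatorname{Tr}\bigl(\Lambda_p(x)\cdots\Lambda_2(x)\Lambda_1(x)\bigr),\qquad \Lambda_n(x)=\frac1{a_n^{(0)}}\begin{pmatrix}x-b_n^{(0)}&-1\\ (a_n^{(0)})^2&0\end{pmatrix},$$ and its isospectral torus $\mathcal T_{J_0}$ is the set of all $p$-periodic two-sided Jacobi matrices whose spectrum, as operators on $\ell^2(\mathbb Z)$, equals that of $J_0$. Let $S$ be the right shift on $\ell^2(\mathbb Z)$, $(Su)_n=u_{n-1}$.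 Then for every two-sided (not a priori periodic) Jacobi matrix $J$, $$\Delta_{J_0}(J)=S^p+S^{-p}\iff J\in\mathcal T_{J_0}.$$ In particular, the identity $\Delta_{J_0}(J)=S^p+S^{-p}$ forces $J$ to be $p$-periodic. -/

import Mathlib

open scoped ENNReal Polynomial

noncomputable section

/-- The complex Hilbert space `ℓ²(ℤ)`. -/
abbrev EllTwoZ : Type := lp (fun _ : ℤ => ℂ) 2

/-- Translation by `k` on `ℓ²(ℤ)`: `(translation k u)ₙ = uₙ₋ₖ`. -/
def translation (k : ℤ) : EllTwoZ →L[ℂ] EllTwoZ :=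
  LinearMap.mkContinuous
    { toFun := fun u => ⟨fun n => u (n - k), by
        have h : Summable fun n : ℤ => ‖u n‖ ^ (2 : ℝ≥0∞).toReal :=
          (memℓp_gen_iff (by norm_num)).1 (lp.memℓp u)
        exact (memℓp_gen_iff (by norm_num)).2 ((Equiv.subRight k).summable_iff.2 h)⟩
      map_add' := fun u v => by ext n; rfl
      map_smul' := fun c u => by ext n; rfl }
    1
    (fun u => by
      rw [one_mul]
      refine le_of_eq ?_
      rw [lp.norm_eq_tsum_rpow (by norm_num), lp.norm_eq_tsum_rpow (by norm_num)]
      congr 1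
      exact (Equiv.subRight k).tsum_eq (fun n : ℤ => ‖u n‖ ^ (2 : ℝ≥0∞).toReal))

@[simp] theorem translation_apply (k : ℤ) (u : EllTwoZ) (n : ℤ) :
    translation k u n = u (n - k) := rfl

/-- The right shift `S` on `ℓ²(ℤ)`, `(S u)ₙ = uₙ₋₁`, as an invertible bounded operator. -/
def rightShift : (EllTwoZ →L[ℂ] EllTwoZ)ˣ where
  val := translation 1
  inv := translation (-1)
  val_inv := by ext u n; simp
  inv_val := by ext u n; simp

/-- The bounded diagonal operator on `ℓ²(ℤ)` with bounded real entries `c n`. -/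
def diagonalOp (c : ℤ → ℝ) (hc : ∃ K : ℝ, ∀ n, |c n| ≤ K) : EllTwoZ →L[ℂ] EllTwoZ :=
  lp.mapCLM 2 (fun n => (c n : ℂ) • ContinuousLinearMap.id ℂ ℂ) (K := hc.choose)
    ((abs_nonneg _).trans (hc.choose_spec 0))
    (fun n => by
      refine (norm_smul_le _ _).trans ?_
      simpa using hc.choose_spec n)

@[simp] theorem diagonalOp_apply (c : ℤ → ℝ) (hc : ∃ K : ℝ, ∀ n, |c n| ≤ K)
    (u : EllTwoZ) (n : ℤ) : diagonalOp c hc u n = c n * u n := by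
  simp [diagonalOp]

/-- A two-sided Jacobi matrix, given by its Jacobi parameters `aₙ > 0`, `bₙ ∈ ℝ` (`n ∈ ℤ`),
which are uniformly bounded. The matrix has diagonal entries `J n n = b n` and off-diagonal
entries `J n (n+1) = J (n+1) n = a n`. -/
@[ext]
structure TwoSidedJacobi where
  a : ℤ → ℝ
  b : ℤ → ℝ
  a_pos : ∀ n, 0 < a n
  a_bdd : ∃ K : ℝ, ∀ n, |a n| ≤ K
  b_bdd : ∃ K : ℝ, ∀ n, |b n| ≤ K

namespace TwoSidedJacobi

/-- The bounded operator on `ℓ²(ℤ)` defined by a two-sided Jacobi matrix; see `op_apply`. -/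
def op (J : TwoSidedJacobi) : EllTwoZ →L[ℂ] EllTwoZ :=
  diagonalOp J.a J.a_bdd * translation (-1) + diagonalOp J.b J.b_bdd
    + translation 1 * diagonalOp J.a J.a_bdd

theorem op_apply (J : TwoSidedJacobi) (u : EllTwoZ) (n : ℤ) :
    J.op u n = J.a n * u (n + 1) + J.b n * u n + J.a (n - 1) * u (n - 1) := by
  simp [op]

/-- The Jacobi parameters are `p`-periodic. -/
def IsPeriodic (J : TwoSidedJacobi) (p : ℕ) : Prop :=
  ∀ n : ℤ, J.a (n + p) = J.a n ∧ J.b (n + p) = J.b n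

/-- The one-step transfer matrix `Λₙ(x) = aₙ⁻¹ (x - bₙ, -1; aₙ², 0)`, as a matrix of polynomials
in `x`. -/
def stepMatrix (J : TwoSidedJacobi) (n : ℤ) : Matrix (Fin 2) (Fin 2) ℝ[X] :=
  Polynomial.C (J.a n)⁻¹ •
    !![Polynomial.X - Polynomial.C (J.b n), -1; Polynomial.C (J.a n ^ 2), 0]

/-- The transfer matrix `Λₖ(x) ⋯ Λ₂(x) Λ₁(x)`. -/
def transferMatrix (J : TwoSidedJacobi) : ℕ → Matrix (Fin 2) (Fin 2) ℝ[X]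
  | 0 => 1
  | k + 1 => J.stepMatrix ((k : ℤ) + 1) * transferMatrix J k

/-- The discriminant: the trace of the transfer matrix over one period `1, …, p`. -/
def discriminant (J : TwoSidedJacobi) (p : ℕ) : ℝ[X] :=
  (J.transferMatrix p).trace

/-- The isospectral torus of a `p`-periodic `J₀`: the set of all `p`-periodic two-sided Jacobi
matrices having the same spectrum, as operators on `ℓ²(ℤ)`, as `J₀`. -/
def isospectralTorus (J₀ : TwoSidedJacobi) (p : ℕ) : Set TwoSidedJacobi :=
  {J | J.IsPeriodic p ∧ spectrum ℂ J.op = spectrum ℂ J₀.op}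

end TwoSidedJacobi

end

/-!
Write `eₙ` for the standard basis of `ℓ²(ℤ)` and `Δ_J` for the discriminant of a `p`-periodic `J`.

The relation `J eₙ = aₙ eₙ₊₁ + bₙ eₙ + aₙ₋₁ eₙ₋₁` says that the vectors `eₙ` solve the eigenvalue
recursion with `J` itself as spectral parameter, so that transfer matrices, whose entries are
polynomials and hence act on vectors through `J`, carry `(eₙ₊₁, aₙ eₙ)` from one `n` to another.
For periodic `J` the Cayley–Hamilton theorem for the unimodular monodromy matrix becomes
`Δ_J(J) eₙ = eₙ₊ₚ + eₙ₋ₚ`, that is, `Δ_J(J) = Sᵖ + S⁻ᵖ`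
(`TwoSidedJacobi.IsPeriodic.aeval_discriminant`).

Whenever `D(J) = Sᵖ + S⁻ᵖ` for a real polynomial `D`, periodic or not, three things follow.
`J` commutes with `Sᵖ + S⁻ᵖ`, and comparing matrix entries makes it periodic
(`TwoSidedJacobi.isPeriodic_of_commute`). `D` has degree `p` and positive leading coefficient, as
one reads off the outermost diagonal (`TwoSidedJacobi.natDegree_and_leadingCoeff_of_magic`). And the
spectrum of `J` is the set of complex `z` with `D(z) ∈ [-2, 2]`
(`TwoSidedJacobi.mem_spectrum_iff_of_magic`): one inclusion is spectral mapping, the other holds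
because a resolvent vector at such a `z` would satisfy a recurrence without nonzero decaying
solutions.

Applied to `J` and to `J₀` with the same polynomial `Δ_{J₀}`, this shows that the magic formula
implies that `J` is in the isospectral torus. Conversely, isospectral periodic `J` and `J₀` have
discriminants of the same degree with positive leading coefficients under which `[-2, 2]` has the
same preimage, and such polynomials `f`, `g` coincide (`Polynomial.eq_of_preimage_Icc_eq`). Indeed,
the sum of `g` over the `p` roots of `f = w` is affine in `w` with slope `p` times the ratio of the
leading coefficients; since `|g| ≤ 2` at the roots of `f = ±2`, this ratio is at most one. By
symmetry it is one, and then equality forces `g = ±2` wherever `f = ±2`. So `f - g`, of degree below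
`p`, vanishes at all roots of `f² - 4`, whose multiplicities are controlled by `f'`; a degree count
gives `f = g`.
-/

/-! ### Polynomials with the same preimage of `[-2, 2]` -/

/-- Power sums of exponent below `d` are determined by the elementary symmetric functions of
degree below `d`, by Newton's identities. -/
theorem sum_pow_eq_of_esymm_eq {d : ℕ} (r s : Fin d → ℂ)
    (h : ∀ j < d, MvPolynomial.aeval r (MvPolynomial.esymm (Fin d) ℂ j) =
      MvPolynomial.aeval s (MvPolynomial.esymm (Fin d) ℂ j)) (k : ℕ) (hk : k < d) :
    ∑ i, r i ^ k = ∑ i, s i ^ k := by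
  suffices H : MvPolynomial.aeval r (MvPolynomial.psum (Fin d) ℂ k) =
      MvPolynomial.aeval s (MvPolynomial.psum (Fin d) ℂ k) by
    simpa [MvPolynomial.psum] using H
  induction k using Nat.strong_induction_on with
  | _ k ih =>
    rcases Nat.eq_zero_or_pos k with rfl | hk0
    · simp [MvPolynomial.psum]
    · rw [MvPolynomial.psum_eq_mul_esymm_sub_sum (Fin d) ℂ k hk0]
      simp only [map_sub, map_mul, map_pow, map_neg, map_one, map_natCast, map_sum, h k hk]
      congr 1
      refine Finset.sum_congr rfl fun a ha => ?_
      obtain ⟨ha1, ha2⟩ := Finset.mem_filter.1 ha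
      rw [Finset.HasAntidiagonal.mem_antidiagonal] at ha1
      rw [Set.mem_Ioo] at ha2
      rw [h a.1 (by omega), ih a.2 (by omega) (by omega)]

theorem Multiset.exists_fin_map_eq {α : Type*} {d : ℕ} (s : Multiset α)
    (hs : Multiset.card s = d) : ∃ r : Fin d → α, Finset.univ.val.map r = s := by
  subst hs
  obtain ⟨l, rfl⟩ := Quot.exists_rep s
  exact ⟨l.get, (Fin.univ_val_map _).trans (congrArg _ (List.ofFn_get l))⟩

namespace Polynomial

/-- The sum of a polynomial `q` of degree below `deg f` over the roots of `f - w`, counted with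
multiplicity, does not depend on `w`. -/
theorem sum_eval_roots_sub_C (f q : ℂ[X]) (hq : q.natDegree < f.natDegree) (w : ℂ) :
    ((f - C w).roots.map fun z => q.eval z).sum = (f.roots.map fun z => q.eval z).sum := by
  have hd : (f - C w).natDegree = f.natDegree := natDegree_sub_C
  have hcard (g : ℂ[X]) : Multiset.card g.roots = g.natDegree :=
    splits_iff_card_roots.1 (IsAlgClosed.splits g)
  obtain ⟨r, hr⟩ := (f - C w).roots.exists_fin_map_eq ((hcard _).trans hd)
  obtain ⟨s, hs⟩ := f.roots.exists_fin_map_eq (hcard _)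
  have hlead : (f - C w).leadingCoeff = f.leadingCoeff := by
    rw [leadingCoeff, leadingCoeff, hd, coeff_sub, coeff_C_of_ne_zero (by omega), sub_zero]
  have hf0 : f.leadingCoeff ≠ 0 := by
    rw [Ne, leadingCoeff_eq_zero]
    rintro rfl
    simp at hq
  have hesymm : ∀ j < f.natDegree, MvPolynomial.aeval r (MvPolynomial.esymm _ ℂ j) =
      MvPolynomial.aeval s (MvPolynomial.esymm _ ℂ j) := by
    intro j hj
    rw [MvPolynomial.aeval_esymm_eq_multiset_esymm, MvPolynomial.aeval_esymm_eq_multiset_esymm,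
      hr, hs]
    have h1 := coeff_eq_esymm_roots_of_card (hcard (f - C w)) (k := f.natDegree - j)
      (by rw [hd]; omega)
    have h2 := coeff_eq_esymm_roots_of_card (hcard f) (k := f.natDegree - j) (by omega)
    rw [hd, hlead, coeff_sub, coeff_C_of_ne_zero (by omega), sub_zero, h2,
      Nat.sub_sub_self hj.le] at h1
    exact (mul_left_cancel₀ (mul_ne_zero hf0 (pow_ne_zero _ (by norm_num))) h1).symm
  rw [← hr, ← hs, Multiset.map_map, Multiset.map_map]
  change ∑ i, q.eval (r i) = ∑ i, q.eval (s i)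
  simp only [eval_eq_sum_range]
  rw [Finset.sum_comm, Finset.sum_comm (s := Finset.univ)]
  refine Finset.sum_congr rfl fun k hk => ?_
  rw [← Finset.mul_sum, ← Finset.mul_sum, sum_pow_eq_of_esymm_eq r s hesymm k]
  have := Finset.mem_range.1 hk
  omega

/-- The sum of `g` over the roots of `f - w` is affine in `w`: subtracting a multiple of `f` reduces
to a polynomial of degree below `deg f`. -/
theorem sum_eval_roots_sub_C_of_natDegree_eq (f g : ℂ[X]) (hf : 0 < f.natDegree)
    (hfg : g.natDegree = f.natDegree) (w : ℂ) :
    ((f - C w).roots.map fun z => g.eval z).sum =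
      f.natDegree * (g.leadingCoeff / f.leadingCoeff) * w + (f.roots.map fun z => g.eval z).sum := by
  have hf0 : f.leadingCoeff ≠ 0 := by
    rw [Ne, leadingCoeff_eq_zero]
    rintro rfl
    simp at hf
  set c := g.leadingCoeff / f.leadingCoeff with hc
  have hc' : c * f.leadingCoeff = g.leadingCoeff := div_mul_cancel₀ _ hf0
  obtain ⟨q, hq⟩ : ∃ q, q = g - C c * f := ⟨_, rfl⟩
  have hqd : q.natDegree < f.natDegree := by
    rcases Nat.lt_or_ge q.natDegree f.natDegree with h | h
    · exact h
    · exfalso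
      have hle : q.natDegree ≤ f.natDegree := by
        rw [hq]
        refine (natDegree_sub_le _ _).trans (max_le hfg.le ?_)
        exact natDegree_C_mul_le _ _
      have heq := le_antisymm hle h
      have : q.leadingCoeff = 0 := by
        rw [leadingCoeff, heq, hq, coeff_sub, coeff_C_mul, coeff_natDegree, ← hfg,
          coeff_natDegree, hc', sub_self]
      rw [leadingCoeff_eq_zero] at this
      rw [this, natDegree_zero] at heq
      omega
  have hg (z : ℂ) : g.eval z = c * f.eval z + q.eval z := by simp [hq]
  have hsum (v : ℂ) : ((f - C v).roots.map fun z => g.eval z).sum =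
      f.natDegree * c * v + ((f - C v).roots.map fun z => q.eval z).sum := by
    have h1 : (f - C v).roots.map (fun z => g.eval z) =
        (f - C v).roots.map (fun z => c * v + q.eval z) := by
      refine Multiset.map_congr rfl fun z hz => ?_
      have : f.eval z = v := by
        have := (mem_roots'.1 hz).2
        simpa [IsRoot, sub_eq_zero] using this
      rw [hg, this]
    rw [h1, Multiset.sum_map_add, Multiset.map_const', Multiset.sum_replicate,
      splits_iff_card_roots.1 (IsAlgClosed.splits (f - C v)), natDegree_sub_C, nsmul_eq_mul,
      mul_assoc]
  have h0 := hsum 0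
  rw [map_zero, sub_zero, mul_zero, zero_add] at h0
  rw [hsum, sum_eval_roots_sub_C f q hqd w, h0]

/-- A nonzero polynomial of degree below `deg f` cannot vanish at every point where `f = ±2`:
counted with multiplicity there are `2 deg f` such points, and `f'` only accounts for
`deg f - 1` coincidences. -/
theorem eq_zero_of_isRoot_of_sq_eq (f D : ℂ[X]) (hD : D.natDegree < f.natDegree)
    (h : ∀ z, f.eval z ^ 2 = 4 → D.IsRoot z) : D = 0 := by
  by_contra hD0
  have hf' : derivative f ≠ 0 := by
    intro h0
    have := derivative_eq_zero.1 h0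
    omega
  set F : ℂ[X] := f ^ 2 - C 4 with hF
  have hFd : F.natDegree = 2 * f.natDegree := by
    rw [hF, natDegree_sub_C, natDegree_pow]
  have hF0 : F ≠ 0 := by
    intro h0
    rw [h0, natDegree_zero] at hFd
    omega
  have hprod : derivative f * D ≠ 0 := mul_ne_zero hf' hD0
  have hle : F.roots ≤ (derivative f * D).roots := by
    rw [Multiset.le_iff_count]
    intro z
    rw [count_roots, count_roots]
    by_cases hz : F.IsRoot z
    · have hz2 : f.eval z ^ 2 = 4 := by
        simpa [hF, IsRoot, sub_eq_zero] using hz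
      have hfz : f.eval z ≠ 0 := by
        intro h0
        simp [h0] at hz2
      have hder : derivative F = C 2 * f * derivative f := by
        rw [hF, derivative_sub, derivative_C, sub_zero, derivative_pow]
        simp
      have hder0 : C 2 * f * derivative f ≠ 0 := by
        refine mul_ne_zero (mul_ne_zero (by simp) ?_) hf'
        rintro rfl
        simp at hfz
      have hm := derivative_rootMultiplicity_of_root hz
      rw [hder, rootMultiplicity_mul hder0, rootMultiplicity_eq_zero (by simpa [IsRoot] using hfz),
        zero_add] at hm
      have hDz : 0 < D.rootMultiplicity z := (rootMultiplicity_pos hD0).2 (h z hz2)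
      rw [rootMultiplicity_mul hprod, hm]
      omega
    · rw [rootMultiplicity_eq_zero hz]
      exact Nat.zero_le _
  have hcard := Multiset.card_le_card hle
  rw [splits_iff_card_roots.1 (IsAlgClosed.splits F),
    splits_iff_card_roots.1 (IsAlgClosed.splits (derivative f * D)),
    natDegree_mul hf' hD0, hFd] at hcard
  have := natDegree_derivative_le f
  omega

end Polynomial

theorem Multiset.sum_le_card_mul {α : Type*} (s : Multiset α) (φ : α → ℝ) (c : ℝ)
    (h : ∀ z ∈ s, φ z ≤ c) : (s.map φ).sum ≤ Multiset.card s * c := by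
  have := Multiset.sum_le_card_nsmul (s.map φ) c (by simpa using h)
  simpa using this

theorem Multiset.eq_of_card_mul_le_sum {α : Type*} (s : Multiset α) (φ : α → ℝ) (c : ℝ)
    (h : ∀ z ∈ s, φ z ≤ c) (hs : Multiset.card s * c ≤ (s.map φ).sum) : ∀ z ∈ s, φ z = c := by
  intro z hz
  obtain ⟨t, rfl⟩ := Multiset.exists_cons_of_mem hz
  have h1 := t.sum_le_card_mul φ c fun y hy => h y (Multiset.mem_cons_of_mem hy)
  have h2 := h z hz
  simp only [Multiset.map_cons, Multiset.sum_cons, Multiset.card_cons, Nat.cast_add,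
    Nat.cast_one] at hs
  linarith

namespace Polynomial

/-- The averages of `g` over the roots of `f = 2` and of `f = -2` differ by four times the ratio of
the leading coefficients. -/
theorem sum_re_eval_roots_sub (f g : ℝ[X]) (hf : 0 < f.natDegree)
    (hfg : g.natDegree = f.natDegree) :
    (((f.map (algebraMap ℝ ℂ) - C 2).roots.map
        fun z => ((g.map (algebraMap ℝ ℂ)).eval z).re).sum -
      ((f.map (algebraMap ℝ ℂ) - C (-2)).roots.map
        fun z => ((g.map (algebraMap ℝ ℂ)).eval z).re).sum) =
      f.natDegree * (g.leadingCoeff / f.leadingCoeff) * 4 := by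
  have hre (s : Multiset ℂ) (φ : ℂ → ℂ) : (s.map fun z => (φ z).re).sum = (s.map φ).sum.re := by
    induction s using Multiset.induction_on with
    | empty => simp
    | cons a s ih => simp [ih]
  have key := sum_eval_roots_sub_C_of_natDegree_eq (f.map (algebraMap ℝ ℂ))
    (g.map (algebraMap ℝ ℂ)) (by simpa using hf) (by simpa using hfg)
  rw [hre, hre, key 2, key (-2), ← Complex.sub_re]
  simp only [natDegree_map, leadingCoeff_map, Complex.coe_algebraMap]
  rw [show ∀ x y : ℂ, x * 2 + y - (x * -2 + y) = x * 4 by intros; ring]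
  rw [← Complex.ofReal_div, ← Complex.ofReal_natCast, ← Complex.ofReal_mul]
  simp

/-- If `g` maps the preimage of `[-2, 2]` under `f` into `[-2, 2]`, its leading coefficient is at
most that of `f`, because the averages of `g` over the roots of `f = 2` and of `f = -2` differ by at
most `4`. In case of equality all values averaged are extremal. -/
theorem leadingCoeff_le_of_preimage_subset (f g : ℝ[X]) (hf : 0 < f.natDegree)
    (hfg : g.natDegree = f.natDegree) (hfpos : 0 < f.leadingCoeff)
    (h : ∀ z : ℂ, (∃ t ∈ Set.Icc (-2 : ℝ) 2, aeval z f = t) →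
      ∃ t ∈ Set.Icc (-2 : ℝ) 2, aeval z g = t) :
    g.leadingCoeff ≤ f.leadingCoeff ∧ (g.leadingCoeff = f.leadingCoeff →
      ∀ z : ℂ, (aeval z f = 2 → aeval z g = 2) ∧ (aeval z f = -2 → aeval z g = -2)) := by
  have hsum := sum_re_eval_roots_sub f g hf hfg
  have hF (w : ℂ) (z : ℂ) : z ∈ (f.map (algebraMap ℝ ℂ) - C w).roots ↔ aeval z f = w := by
    rw [mem_roots, IsRoot, eval_sub, eval_C, sub_eq_zero, eval_map_algebraMap]
    intro h0
    have : (f.map (algebraMap ℝ ℂ) - C w).natDegree = f.natDegree := by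
      rw [natDegree_sub_C, natDegree_map]
    rw [h0, natDegree_zero] at this
    omega
  have hcard (w : ℂ) : Multiset.card (f.map (algebraMap ℝ ℂ) - C w).roots = f.natDegree := by
    rw [splits_iff_card_roots.1 (IsAlgClosed.splits _), natDegree_sub_C, natDegree_map]
  have hb (w : ℝ) (hw : w ∈ Set.Icc (-2 : ℝ) 2) (z : ℂ)
      (hz : z ∈ (f.map (algebraMap ℝ ℂ) - C (w : ℂ)).roots) :
      ((aeval z g).re ≤ 2 ∧ -(aeval z g).re ≤ 2) ∧ aeval z g = ((aeval z g).re : ℂ) := by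
    obtain ⟨t, ht, hgt⟩ := h z ⟨w, hw, (hF _ _).1 hz⟩
    rw [hgt]
    simp only [Complex.ofReal_re, and_true]
    exact ⟨ht.2, by linarith [ht.1]⟩
  have hb2 := hb 2 (by constructor <;> norm_num)
  have hb2' := hb (-2) (by constructor <;> norm_num)
  push_cast at hb2 hb2'
  simp only [eval_map_algebraMap] at hsum
  set s := (f.map (algebraMap ℝ ℂ) - C 2).roots with hs
  set s' := (f.map (algebraMap ℝ ℂ) - C (-2)).roots with hs'
  have h1 := s.sum_le_card_mul (fun z => (aeval z g).re) 2 fun z hz => (hb2 z hz).1.1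
  have h2 := s'.sum_le_card_mul (fun z => -(aeval z g).re) 2 fun z hz => (hb2' z hz).1.2
  have hneg : (s'.map fun z => -(aeval z g).re).sum = -(s'.map fun z => (aeval z g).re).sum := by
    rw [← Multiset.sum_map_neg', Multiset.map_map]
    rfl
  have hd : (0 : ℝ) < f.natDegree := by exact_mod_cast hf
  constructor
  · rw [hneg] at h2
    rw [hs, hcard] at h1
    rw [hs', hcard] at h2
    have : (f.natDegree : ℝ) * (g.leadingCoeff / f.leadingCoeff) ≤ f.natDegree * 1 := by linarith
    have := le_of_mul_le_mul_left this hd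
    rwa [div_le_one hfpos] at this
  · intro heq z
    rw [heq, div_self hfpos.ne', mul_one] at hsum
    have hc : (Multiset.card s : ℝ) = f.natDegree := by rw [hs, hcard]
    have hc' : (Multiset.card s' : ℝ) = f.natDegree := by rw [hs', hcard]
    rw [hneg, hc'] at h2
    rw [hc] at h1
    constructor
    · intro hz
      have hz := (hF _ _).2 hz
      rw [(hb2 z hz).2, s.eq_of_card_mul_le_sum (fun z => (aeval z g).re) 2
        (fun z hz => (hb2 z hz).1.1) (by rw [hc]; linarith) z hz]
      simp
    · intro hz
      have hz := (hF _ _).2 hz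
      have := s'.eq_of_card_mul_le_sum (fun z => -(aeval z g).re) 2
        (fun z hz => (hb2' z hz).1.2)
        (by rw [hneg, hc']; linarith) z hz
      rw [(hb2' z hz).2, neg_eq_iff_eq_neg.1 this]
      simp

/-- Two real polynomials of the same positive degree and with positive leading coefficients
coincide as soon as `[-2, 2]` has the same preimage in `ℂ` under both. -/
theorem eq_of_preimage_Icc_eq (f g : ℝ[X]) (hf : 0 < f.natDegree)
    (hfg : g.natDegree = f.natDegree) (hfpos : 0 < f.leadingCoeff) (hgpos : 0 < g.leadingCoeff)
    (h : ∀ z : ℂ, (∃ t ∈ Set.Icc (-2 : ℝ) 2, aeval z f = t) ↔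
      ∃ t ∈ Set.Icc (-2 : ℝ) 2, aeval z g = t) : f = g := by
  obtain ⟨h1, h1'⟩ := leadingCoeff_le_of_preimage_subset f g hf hfg hfpos fun z => (h z).1
  obtain ⟨h2, -⟩ := leadingCoeff_le_of_preimage_subset g f (by omega) hfg.symm hgpos
    fun z => (h z).2
  have heq := le_antisymm h1 h2
  have hval := h1' heq
  have hD : ((g - f).map (algebraMap ℝ ℂ)) = 0 := by
    refine eq_zero_of_isRoot_of_sq_eq (f.map (algebraMap ℝ ℂ)) _ ?_ ?_
    · rw [natDegree_map, natDegree_map]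
      have hf0 : f ≠ 0 := by
        rintro rfl
        simp at hf
      have hg0 : g ≠ 0 := by
        rintro rfl
        simp at hgpos
      have hdeg : g.degree = f.degree := by
        rw [degree_eq_natDegree hf0, degree_eq_natDegree hg0, hfg]
      by_cases h0 : g - f = 0
      · rw [h0, natDegree_zero]
        exact hf
      · have := degree_sub_lt_left hdeg hg0 heq
        rw [hdeg] at this
        exact natDegree_lt_natDegree h0 this
    · intro z hz
      rw [eval_map_algebraMap] at hz
      rw [IsRoot, eval_map_algebraMap, map_sub, sub_eq_zero]
      have : (aeval z f - 2) * (aeval z f + 2) = 0 := by linear_combination hz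
      rcases mul_eq_zero.1 this with h0 | h0
      · have h0 := sub_eq_zero.1 h0
        rw [h0, (hval z).1 h0]
      · have h0 := eq_neg_of_add_eq_zero_left h0
        rw [h0, (hval z).2 h0]
  rw [Polynomial.map_eq_zero] at hD
  exact (sub_eq_zero.1 hD).symm

end Polynomial

noncomputable section

/-! ### The standard basis of `ℓ²(ℤ)` -/

/-- The standard basis vector `eₙ` of `ℓ²(ℤ)`. -/
def EllTwoZ.basisVec (n : ℤ) : EllTwoZ := lp.single 2 n (1 : ℂ)

theorem EllTwoZ.basisVec_apply (n m : ℤ) : EllTwoZ.basisVec n m = if m = n then 1 else 0 := by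
  simp [EllTwoZ.basisVec, Pi.single_apply]

theorem ContinuousLinearMap.ext_basisVec {A B : EllTwoZ →L[ℂ] EllTwoZ}
    (h : ∀ n, A (EllTwoZ.basisVec n) = B (EllTwoZ.basisVec n)) : A = B := by
  refine lp.ext_continuousLinearMap (by norm_num) fun n => ?_
  ext1
  exact h n

theorem translation_basisVec (k n : ℤ) :
    translation k (EllTwoZ.basisVec n) = EllTwoZ.basisVec (n + k) := by
  ext m
  simp only [translation_apply, EllTwoZ.basisVec_apply, sub_eq_iff_eq_add]

theorem translation_mul (k l : ℤ) : translation k * translation l = translation (k + l) := by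
  ext u n
  simp [sub_sub]

theorem translation_zero : translation 0 = 1 := by
  ext u n
  simp

theorem rightShift_pow_val (p : ℕ) :
    ((rightShift ^ p : (EllTwoZ →L[ℂ] EllTwoZ)ˣ) : EllTwoZ →L[ℂ] EllTwoZ) = translation p := by
  induction p with
  | zero => simp [translation_zero]
  | succ p ih =>
    rw [pow_succ, Units.val_mul, ih]
    change translation p * translation 1 = _
    rw [translation_mul]
    push_cast
    rfl

theorem rightShift_zpow_neg_val (p : ℕ) :
    ((rightShift ^ (-(p : ℤ)) : (EllTwoZ →L[ℂ] EllTwoZ)ˣ) : EllTwoZ →L[ℂ] EllTwoZ) =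
      translation (-p) := by
  rw [zpow_neg, zpow_natCast]
  refine Units.inv_eq_of_mul_eq_one_right ?_
  rw [rightShift_pow_val, translation_mul, add_neg_cancel, translation_zero]

theorem norm_translation_le (k : ℤ) : ‖translation k‖ ≤ 1 :=
  LinearMap.mkContinuous_norm_le _ zero_le_one _

namespace TwoSidedJacobi

open EllTwoZ Polynomial

variable (J : TwoSidedJacobi)

theorem op_basisVec (n : ℤ) : J.op (basisVec n) =
    (J.a n : ℂ) • basisVec (n + 1) + (J.b n : ℂ) • basisVec n
      + (J.a (n - 1) : ℂ) • basisVec (n - 1) := by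
  ext m
  simp only [op_apply, basisVec_apply, lp.coeFn_add, lp.coeFn_smul, Pi.add_apply, Pi.smul_apply,
    smul_eq_mul]
  rcases eq_or_ne m n with rfl | h0
  · simp [show m ≠ m - 1 by omega]
  · rcases eq_or_ne m (n + 1) with rfl | h1
    · simp [show n + 1 + 1 ≠ n by omega, show n + 1 ≠ n - 1 by omega]
    · rcases eq_or_ne m (n - 1) with rfl | h2
      · simp [show n - 1 - 1 ≠ n by omega, show n - 1 ≠ n + 1 by omega]
      · simp [h0, h1, h2, show m + 1 ≠ n by omega, show m - 1 ≠ n by omega]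

end TwoSidedJacobi

/-! ### Transfer matrices acting on vectors -/

/-- A `2 × 2` matrix of real polynomials acts on pairs of vectors, the indeterminate acting as the
operator `A`. -/
def polyMatrixAct (A : EllTwoZ →L[ℂ] EllTwoZ) (T : Matrix (Fin 2) (Fin 2) ℝ[X])
    (v : Fin 2 → EllTwoZ) : Fin 2 → EllTwoZ :=
  fun i => ∑ j, Polynomial.aeval A (T i j) (v j)

theorem polyMatrixAct_mul (A : EllTwoZ →L[ℂ] EllTwoZ) (T U : Matrix (Fin 2) (Fin 2) ℝ[X])
    (v : Fin 2 → EllTwoZ) :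
    polyMatrixAct A (T * U) v = polyMatrixAct A T (polyMatrixAct A U v) := by
  funext i
  simp only [polyMatrixAct, Matrix.mul_apply, Fin.sum_univ_two, map_add, map_mul,
    add_apply, mul_apply_eq_comp]
  abel

/-- The Cayley–Hamilton theorem for a `2 × 2` matrix of determinant one. -/
theorem Matrix.mul_self_fin_two_of_det_eq_one {R : Type*} [CommRing R]
    (T : Matrix (Fin 2) (Fin 2) R) (h : T.det = 1) : T * T = T.trace • T - 1 := by
  rw [Matrix.det_fin_two] at h
  ext i j
  fin_cases i <;> fin_cases j <;>
    simp [Matrix.mul_apply, Fin.sum_univ_two, Matrix.trace_fin_two]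
  · linear_combination -h
  · ring
  · ring
  · linear_combination -h

namespace TwoSidedJacobi

open EllTwoZ Polynomial

variable (J : TwoSidedJacobi)

/-- The transfer matrix `Λ_{m+k}(x) ⋯ Λ_{m+1}(x)` with an arbitrary base point `m`. -/
def transferFrom (m : ℤ) : ℕ → Matrix (Fin 2) (Fin 2) ℝ[X]
  | 0 => 1
  | k + 1 => J.stepMatrix (m + k + 1) * transferFrom m k

theorem transferFrom_zero_left (k : ℕ) : J.transferFrom 0 k = J.transferMatrix k := by
  induction k with
  | zero => rfl
  | succ k ih => rw [transferFrom, transferMatrix, ih, zero_add]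

theorem det_stepMatrix (n : ℤ) : (J.stepMatrix n).det = 1 := by
  have h : (J.a n)⁻¹ * ((J.a n)⁻¹ * J.a n ^ 2) = 1 := by
    have := (J.a_pos n).ne'
    field_simp
  rw [stepMatrix, Matrix.det_fin_two]
  simp only [Matrix.smul_apply, smul_eq_mul]
  simp only [Matrix.cons_val', Matrix.cons_val_zero, Matrix.cons_val_one, Matrix.of_apply,
    Matrix.cons_val_fin_one, mul_zero, zero_sub]
  have h' := congrArg (C : ℝ → ℝ[X]) h
  simp only [map_mul, map_one] at h'
  linear_combination h'

theorem det_transferFrom (m : ℤ) (k : ℕ) : (J.transferFrom m k).det = 1 := by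
  induction k with
  | zero => simp [transferFrom]
  | succ k ih => rw [transferFrom, Matrix.det_mul, ih, det_stepMatrix, mul_one]

theorem transferFrom_succ_mul (m : ℤ) (k : ℕ) :
    J.transferFrom (m + 1) k * J.stepMatrix (m + 1) = J.transferFrom m (k + 1) := by
  induction k with
  | zero => simp [transferFrom]
  | succ k ih =>
    rw [transferFrom, mul_assoc, ih]
    change _ = J.stepMatrix (m + (k + 1 : ℕ) + 1) * J.transferFrom m (k + 1)
    rw [show m + 1 + (k : ℤ) + 1 = m + (k + 1 : ℕ) + 1 by push_cast; ring]

variable {J} in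
theorem IsPeriodic.stepMatrix_add {p : ℕ} (h : J.IsPeriodic p) (n : ℤ) :
    J.stepMatrix (n + p) = J.stepMatrix n := by
  rw [stepMatrix, stepMatrix, (h n).1, (h n).2]

variable {J} in
theorem IsPeriodic.transferFrom_add {p : ℕ} (h : J.IsPeriodic p) (m : ℤ) (k : ℕ) :
    J.transferFrom (m + p) k = J.transferFrom m k := by
  induction k with
  | zero => rfl
  | succ k ih =>
    rw [transferFrom, transferFrom, ih, ← h.stepMatrix_add (m + k + 1)]
    rw [show m + (p : ℤ) + k + 1 = m + k + 1 + p by ring]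

variable {J} in
/-- Monodromy matrices at neighbouring base points are conjugate. -/
theorem IsPeriodic.trace_transferFrom_add_one {p : ℕ} (h : J.IsPeriodic p) (m : ℤ) :
    (J.transferFrom (m + 1) p).trace = (J.transferFrom m p).trace := by
  have hdet := J.det_stepMatrix (m + 1)
  set L := J.stepMatrix (m + 1) with hL
  have h1 : J.transferFrom (m + 1) p * L = L * J.transferFrom m p := by
    rw [hL, transferFrom_succ_mul, transferFrom, ← h.stepMatrix_add (m + 1)]
    rw [show m + 1 + (p : ℤ) = m + p + 1 by ring]
  have h2 : L * L.adjugate = 1 := by rw [Matrix.mul_adjugate, hdet, one_smul]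
  have h3 : L.adjugate * L = 1 := by rw [Matrix.adjugate_mul, hdet, one_smul]
  calc (J.transferFrom (m + 1) p).trace
      = (J.transferFrom (m + 1) p * L * L.adjugate).trace := by rw [mul_assoc, h2, mul_one]
    _ = (L.adjugate * (L * J.transferFrom m p)).trace := by rw [Matrix.trace_mul_comm, h1]
    _ = (J.transferFrom m p).trace := by rw [← mul_assoc, h3, one_mul]

variable {J} in
theorem IsPeriodic.trace_transferFrom {p : ℕ} (h : J.IsPeriodic p) (m : ℤ) :
    (J.transferFrom m p).trace = J.discriminant p := by
  induction m using Int.induction_on with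
  | zero => rw [transferFrom_zero_left, discriminant]
  | succ i ih => rw [h.trace_transferFrom_add_one, ih]
  | pred i ih => rw [← h.trace_transferFrom_add_one, sub_add_cancel, ih]

/-! ### The discriminant of a periodic Jacobi matrix -/

/-- The pair `(eₙ₊₁, aₙ eₙ)`. -/
def basisPair (n : ℤ) : Fin 2 → EllTwoZ := ![basisVec (n + 1), (J.a n : ℂ) • basisVec n]

/-- Read in the vector variable, the three-term relation for the basis vectors `eₙ` is the
eigenvalue recursion with `J` itself in place of the spectral parameter. -/
theorem polyMatrixAct_stepMatrix (n : ℤ) :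
    polyMatrixAct J.op (J.stepMatrix (n + 1)) (J.basisPair n) = J.basisPair (n + 1) := by
  have ha : (J.a (n + 1) : ℂ) ≠ 0 := by exact_mod_cast (J.a_pos (n + 1)).ne'
  have hC (r : ℝ) (v : EllTwoZ) : aeval J.op (C r) v = (r : ℂ) • v := by
    rw [aeval_C, Algebra.algebraMap_eq_smul_one]
    rfl
  funext i
  fin_cases i
  · simp only [polyMatrixAct, basisPair, stepMatrix, Fin.sum_univ_two, Matrix.smul_apply,
      Fin.zero_eta, Matrix.of_apply, Matrix.cons_val', Matrix.cons_val_zero, Matrix.cons_val_one,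
      Matrix.cons_val_fin_one, smul_eq_mul, map_mul, map_sub, aeval_X, map_neg, map_one,
      mul_apply_eq_comp, sub_apply, neg_apply,
      one_apply_eq_self, hC, op_basisVec]
    rw [show n + 1 - 1 = n by ring, ← smul_add]
    rw [show (((J.a (n + 1) : ℂ) • basisVec (n + 1 + 1) + (J.b (n + 1) : ℂ) • basisVec (n + 1) +
      (J.a n : ℂ) • basisVec n - (J.b (n + 1) : ℂ) • basisVec (n + 1) +
      -((J.a n : ℂ) • basisVec n)) : EllTwoZ) = (J.a (n + 1) : ℂ) • basisVec (n + 1 + 1) by abel,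
      smul_smul, Complex.ofReal_inv, inv_mul_cancel₀ ha, one_smul]
  · simp only [polyMatrixAct, basisPair, stepMatrix, Fin.sum_univ_two, Matrix.smul_apply,
      Fin.mk_one, Matrix.of_apply, Matrix.cons_val', Matrix.cons_val_zero, Matrix.cons_val_one,
      Matrix.cons_val_fin_one, smul_eq_mul, map_mul, map_zero,
      mul_apply_eq_comp, zero_apply, hC, smul_zero, add_zero]
    rw [smul_smul]
    congr 1
    push_cast
    field_simp

theorem polyMatrixAct_transferFrom (m : ℤ) (k : ℕ) :
    polyMatrixAct J.op (J.transferFrom m k) (J.basisPair m) = J.basisPair (m + k) := by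
  induction k with
  | zero =>
    funext i
    fin_cases i <;> simp [polyMatrixAct, transferFrom, Fin.sum_univ_two, Matrix.one_apply]
  | succ k ih =>
    rw [transferFrom, polyMatrixAct_mul, ih, polyMatrixAct_stepMatrix]
    push_cast
    rw [add_assoc]

variable {J} in
/-- A periodic Jacobi matrix satisfies the magic formula with its own discriminant. -/
theorem IsPeriodic.aeval_discriminant {p : ℕ} (h : J.IsPeriodic p) :
    aeval J.op (J.discriminant p) = translation p + translation (-p) := by
  refine ContinuousLinearMap.ext_basisVec fun n => ?_
  rw [add_apply, translation_basisVec, translation_basisVec]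
  -- The base point is chosen so that the monodromy matrix leads to `eₙ` after one period.
  obtain ⟨m, rfl⟩ : ∃ m : ℤ, n = m + p + 1 := ⟨n - p - 1, by ring⟩
  have h1 := J.polyMatrixAct_transferFrom m p
  have h2 := J.polyMatrixAct_transferFrom (m + p) p
  rw [h.transferFrom_add, ← h1, ← polyMatrixAct_mul,
    Matrix.mul_self_fin_two_of_det_eq_one _ (J.det_transferFrom m p), h.trace_transferFrom,
    sub_eq_add_neg] at h2
  have h3 := congrFun h1 0
  have h4 := congrFun h2 0
  simp only [polyMatrixAct, Fin.sum_univ_two, Matrix.add_apply, Matrix.smul_apply,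
    Matrix.neg_apply, smul_eq_mul, map_add, map_mul, map_neg, Matrix.one_apply_eq,
    ne_eq, zero_ne_one, not_false_eq_true, Matrix.one_apply_ne, map_zero, map_one,
    add_apply, mul_apply_eq_comp, neg_apply,
    one_apply_eq_self, zero_apply, neg_zero, add_zero] at h3 h4
  have h5 : aeval J.op (J.discriminant p) (basisVec (m + p + 1)) - basisVec (m + 1) =
      basisVec (m + p + p + 1) := by
    have h6 := congrArg (aeval J.op (J.discriminant p)) h3
    simp only [map_add] at h6
    simp only [basisPair, Matrix.cons_val_zero, Matrix.cons_val_one,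
      Matrix.cons_val_fin_one] at h4 h6
    rw [← h4, ← h6]
    abel
  rw [sub_eq_iff_eq_add] at h5
  rw [h5]
  congr 2 <;> ring

end TwoSidedJacobi

namespace TwoSidedJacobi

open EllTwoZ Polynomial

variable (J : TwoSidedJacobi)

/-! ### Polynomials in a Jacobi matrix -/

/-- `Jᵏ` is a band matrix of half-width `k` with positive entries on its outermost diagonal. -/
theorem op_pow_basisVec_zero_apply (k : ℕ) :
    (∀ n : ℤ, (k : ℤ) < |n| → (J.op ^ k) (basisVec 0) n = 0) ∧
      ∃ r : ℝ, 0 < r ∧ (J.op ^ k) (basisVec 0) k = r := by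
  induction k with
  | zero =>
    refine ⟨fun n hn => ?_, 1, one_pos, by simp [basisVec_apply]⟩
    rw [pow_zero, one_apply_eq_self, basisVec_apply, if_neg]
    rintro rfl
    simp at hn
  | succ k ih =>
    obtain ⟨h0, r, hr, hrk⟩ := ih
    have hsucc (n : ℤ) : (J.op ^ (k + 1)) (basisVec 0) n =
        J.a n * (J.op ^ k) (basisVec 0) (n + 1) + J.b n * (J.op ^ k) (basisVec 0) n +
          J.a (n - 1) * (J.op ^ k) (basisVec 0) (n - 1) := by
      rw [pow_succ', mul_apply_eq_comp, op_apply]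
    constructor
    · intro n hn
      rw [Nat.cast_add, Nat.cast_one, lt_abs] at hn
      rw [hsucc, h0 (n + 1) (lt_abs.2 (by omega)), h0 n (lt_abs.2 (by omega)),
        h0 (n - 1) (lt_abs.2 (by omega))]
      simp
    · refine ⟨J.a k * r, mul_pos (J.a_pos k) hr, ?_⟩
      rw [hsucc, Nat.cast_add, Nat.cast_one, h0 (k + 1 + 1) (lt_abs.2 (by omega)),
        h0 (k + 1) (lt_abs.2 (by omega)), add_sub_cancel_right, hrk]
      simp

/-- A polynomial in `J` of degree `d` is a band matrix of half-width `d`. -/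
theorem aeval_basisVec_zero_apply_of_lt (Q : ℂ[X]) (n : ℤ) (hn : (Q.natDegree : ℤ) < |n|) :
    aeval J.op Q (basisVec 0) n = 0 := by
  rw [aeval_eq_sum_range, sum_apply, lp.coeFn_sum, Finset.sum_apply]
  refine Finset.sum_eq_zero fun k hk => ?_
  have hk := Finset.mem_range.1 hk
  rw [smul_apply, lp.coeFn_smul, Pi.smul_apply,
    (J.op_pow_basisVec_zero_apply k).1 n (by omega), smul_zero]

/-- The outermost diagonal of a polynomial in `J` is the leading coefficient up to positive
factors. -/
theorem aeval_basisVec_zero_apply_natDegree (Q : ℂ[X]) :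
    ∃ r : ℝ, 0 < r ∧ aeval J.op Q (basisVec 0) Q.natDegree = r * Q.leadingCoeff := by
  obtain ⟨r, hr, hrk⟩ := (J.op_pow_basisVec_zero_apply Q.natDegree).2
  refine ⟨r, hr, ?_⟩
  rw [aeval_eq_sum_range, sum_apply, lp.coeFn_sum, Finset.sum_apply,
    Finset.sum_range_succ, Finset.sum_eq_zero, zero_add]
  · rw [smul_apply, lp.coeFn_smul, Pi.smul_apply, hrk, smul_eq_mul, mul_comm]
    rfl
  · intro k hk
    have hk := Finset.mem_range.1 hk
    rw [smul_apply, lp.coeFn_smul, Pi.smul_apply,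
      (J.op_pow_basisVec_zero_apply k).1 _ (by rw [Nat.abs_cast]; omega), smul_zero]

theorem aeval_map_ofReal (D : ℝ[X]) : aeval J.op (D.map (algebraMap ℝ ℂ)) = aeval J.op D :=
  aeval_map_algebraMap ℂ J.op D

variable {J} in
/-- A polynomial in the magic formula has degree `p` and positive leading coefficient, since the
outermost diagonal of `Sᵖ + S⁻ᵖ` has distance `p` from the main one and entries `1`. -/
theorem natDegree_and_leadingCoeff_of_magic {p : ℕ} (hp : 0 < p) {D : ℝ[X]}
    (h : aeval J.op D = translation p + translation (-p)) :
    D.natDegree = p ∧ 0 < D.leadingCoeff := by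
  have happ (n : ℤ) : aeval J.op (D.map (algebraMap ℝ ℂ)) (basisVec 0) n =
      (if n = p then 1 else 0) + if n = -p then 1 else 0 := by
    rw [aeval_map_ofReal, h, add_apply, translation_basisVec, translation_basisVec,
      lp.coeFn_add, Pi.add_apply, basisVec_apply, basisVec_apply, zero_add, zero_add]
  have hle : p ≤ D.natDegree := by
    by_contra hlt
    have h1 := J.aeval_basisVec_zero_apply_of_lt (D.map (algebraMap ℝ ℂ)) p
      (by rw [natDegree_map, Nat.abs_cast]; omega)
    rw [happ, if_pos rfl, if_neg (by omega)] at h1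
    simp at h1
  have hD0 : D ≠ 0 := by
    rintro rfl
    simp at hle
    omega
  obtain ⟨r, hr, h2⟩ := J.aeval_basisVec_zero_apply_natDegree (D.map (algebraMap ℝ ℂ))
  rw [happ, natDegree_map, leadingCoeff_map, if_neg (show ¬ (D.natDegree : ℤ) = -p by omega),
    add_zero, Complex.coe_algebraMap] at h2
  have heq : D.natDegree = p := by
    by_contra hne
    rw [if_neg (by exact_mod_cast hne)] at h2
    have : r * D.leadingCoeff = 0 := Complex.ofReal_injective (by simpa using h2.symm)
    exact mul_ne_zero hr.ne' (leadingCoeff_ne_zero.2 hD0) this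
  refine ⟨heq, ?_⟩
  rw [if_pos (by exact_mod_cast heq)] at h2
  have : r * D.leadingCoeff = 1 := Complex.ofReal_injective (by simpa using h2.symm)
  by_contra hneg
  nlinarith [mul_nonneg hr.le (neg_nonneg.2 (not_lt.1 hneg))]

variable {J} in
/-- A Jacobi matrix commuting with `Sᵖ + S⁻ᵖ` is `p`-periodic: its band is too narrow for the two
shifts to interfere. -/
theorem isPeriodic_of_commute {p : ℕ} (hp : 0 < p)
    (h : Commute J.op (translation p + translation (-p))) : J.IsPeriodic p := by
  intro n
  have h0 := congrArg (fun A : EllTwoZ →L[ℂ] EllTwoZ => A (basisVec n)) h.eq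
  simp only [mul_apply_eq_comp, add_apply, translation_basisVec, map_add] at h0
  have h1 := congrArg (fun v : EllTwoZ => v (n + p)) h0
  have h2 := congrArg (fun v : EllTwoZ => v (n + p + 1)) h0
  simp only [lp.coeFn_add, Pi.add_apply, op_apply, translation_apply, basisVec_apply] at h1 h2
  -- As `2p > 1`, only one of the six terms on each side survives.
  constructor
  · rw [if_neg (by omega), if_neg (by omega), if_pos (by omega), if_neg (by omega),
      if_neg (by omega), if_neg (by omega), if_neg (by omega), if_neg (by omega),
      if_pos (by omega), if_neg (by omega), if_neg (by omega), if_neg (by omega)] at h2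
    simp only [mul_zero, mul_one, zero_add, add_zero] at h2
    rw [show n + p + 1 - 1 = n + (p : ℤ) by ring,
      show n + (p : ℤ) + 1 - p - 1 = n by ring] at h2
    exact_mod_cast h2
  · rw [if_neg (by omega), if_pos trivial, if_neg (by omega), if_neg (by omega),
      if_neg (by omega), if_neg (by omega), if_neg (by omega), if_pos (by omega),
      if_neg (by omega), if_neg (by omega), if_neg (by omega), if_neg (by omega)] at h1
    simp only [mul_zero, mul_one, zero_add, add_zero] at h1
    rw [show n + (p : ℤ) - p = n by ring] at h1
    exact_mod_cast h1

end TwoSidedJacobi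

/-! ### The spectrum of a periodic Jacobi matrix -/

theorem Complex.exists_add_inv_eq (w : ℂ) : ∃ l : ℂ, l ≠ 0 ∧ ‖l‖ ≤ 1 ∧ w = l + l⁻¹ := by
  obtain ⟨l, hl⟩ := IsAlgClosed.exists_root
    (Polynomial.X ^ 2 - Polynomial.C w * Polynomial.X + 1 : Polynomial ℂ)
    (by
      have : (Polynomial.X ^ 2 - Polynomial.C w * Polynomial.X + 1 : Polynomial ℂ).degree = 2 := by
        compute_degree!
      rw [this]
      norm_num)
  have hl : l ^ 2 - w * l + 1 = 0 := by simpa [Polynomial.IsRoot] using hl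
  have hl0 : l ≠ 0 := by
    rintro rfl
    simp at hl
  have hw : w = l + l⁻¹ := by
    field_simp
    linear_combination -hl
  rcases le_total ‖l‖ 1 with h | h
  · exact ⟨l, hl0, h, hw⟩
  · refine ⟨l⁻¹, inv_ne_zero hl0, ?_, by rw [inv_inv, add_comm, hw]⟩
    rw [norm_inv]
    exact inv_le_one_of_one_le₀ h

theorem Complex.add_inv_of_norm_eq_one {l : ℂ} (h : ‖l‖ = 1) :
    ∃ t ∈ Set.Icc (-2 : ℝ) 2, l + l⁻¹ = t := by
  refine ⟨2 * l.re, ?_, ?_⟩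
  · have := abs_le.1 ((Complex.abs_re_le_norm l).trans h.le)
    constructor <;> linarith
  · rw [Complex.inv_eq_conj h, Complex.add_conj]

theorem Complex.norm_eq_one_of_add_inv {l : ℂ} (hl0 : l ≠ 0) {t : ℝ}
    (ht : t ∈ Set.Icc (-2 : ℝ) 2) (h : l + l⁻¹ = t) : ‖l‖ = 1 := by
  obtain ⟨ht1, ht2⟩ := ht
  have h1 : l * l + 1 = t * l := by
    rw [← h]
    field_simp
  have hre := congrArg Complex.re h1
  have him := congrArg Complex.im h1
  simp only [Complex.add_re, Complex.mul_re, Complex.one_re, Complex.ofReal_re, Complex.ofReal_im,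
    zero_mul, sub_zero, Complex.add_im, Complex.mul_im, Complex.one_im, add_zero] at hre him
  have hsq : ‖l‖ ^ 2 = 1 := by
    rw [Complex.sq_norm, Complex.normSq_apply]
    rcases eq_or_ne l.im 0 with h0 | h0
    · -- On the real axis `|l + l⁻¹| ≥ 2`, so only `l = ±1` is left.
      rw [h0] at hre ⊢
      have h2 : (l.re - t / 2) ^ 2 = 0 := le_antisymm (by nlinarith) (sq_nonneg _)
      have h3 : l.re = t / 2 := by linarith [pow_eq_zero_iff (two_ne_zero) |>.1 h2]
      nlinarith
    · have h2 : t = 2 * l.re := mul_right_cancel₀ h0 (by linarith)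
      rw [h2] at hre
      linarith
  exact (pow_eq_one_iff_of_nonneg (norm_nonneg l) two_ne_zero).1 hsq

/-- The spectrum of `Sᵖ + S⁻ᵖ` lies in `[-2, 2]`: for `w = l + l⁻¹` with `|l| < 1` the operator
`w - Sᵖ - S⁻ᵖ = l⁻¹ (1 - l Sᵖ) (1 - l S⁻ᵖ)` is invertible. -/
theorem mem_Icc_of_mem_spectrum_translation_add {p : ℤ} {w : ℂ}
    (hw : w ∈ spectrum ℂ (translation p + translation (-p))) :
    ∃ t ∈ Set.Icc (-2 : ℝ) 2, w = t := by
  obtain ⟨l, hl0, hl1, rfl⟩ := Complex.exists_add_inv_eq w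
  rcases hl1.eq_or_lt with h | h
  · exact Complex.add_inv_of_norm_eq_one h
  · exfalso
    rw [spectrum.mem_iff] at hw
    refine hw ?_
    have hu (k : ℤ) : IsUnit (1 - l • translation k) := by
      refine isUnit_one_sub_of_norm_lt_one ?_
      calc ‖l • translation k‖ ≤ ‖l‖ * ‖translation k‖ := norm_smul_le l (translation k)
        _ ≤ ‖l‖ * 1 := by gcongr; exact norm_translation_le k
        _ < 1 := by rwa [mul_one]
    have hfac : algebraMap ℂ (EllTwoZ →L[ℂ] EllTwoZ) (l + l⁻¹) -
        (translation p + translation (-p)) =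
        l⁻¹ • ((1 - l • translation p) * (1 - l • translation (-p))) := by
      have h1 : translation p * translation (-p) = 1 := by
        rw [translation_mul, add_neg_cancel, translation_zero]
      rw [Algebra.algebraMap_eq_smul_one, sub_mul, mul_sub, mul_sub, one_mul, mul_one, one_mul,
        smul_mul_smul_comm, h1]
      simp only [smul_sub, smul_smul, inv_mul_cancel₀ hl0, inv_mul_cancel_left₀ hl0, add_smul,
        one_smul]
      abel
    rw [hfac]
    exact ((hu p).mul (hu (-p))).smul (Units.mk0 l⁻¹ (inv_ne_zero hl0))

/-- A sequence tending to zero with `xⱼ₊₂ + xⱼ = (l + l⁻¹) xⱼ₊₁`, `|l| = 1`, vanishes. -/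
theorem eq_zero_of_recurrence_of_tendsto_zero {l : ℂ} (hl : ‖l‖ = 1) (x : ℕ → ℂ)
    (hx : ∀ j, x (j + 2) + x j = (l + l⁻¹) * x (j + 1))
    (hlim : Filter.Tendsto x Filter.atTop (nhds 0)) : x 0 = 0 := by
  have hl0 : l ≠ 0 := by
    rintro rfl
    simp at hl
  have hgeom (m : ℂ) (hm : ‖m‖ = 1) (y : ℕ → ℂ) (hy : ∀ j, y (j + 1) = m * y j)
      (hylim : Filter.Tendsto y Filter.atTop (nhds 0)) (j : ℕ) : y j = 0 := by
    have hnorm (j : ℕ) : ‖y j‖ = ‖y 0‖ := by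
      induction j with
      | zero => rfl
      | succ j ih => rw [hy, norm_mul, hm, one_mul, ih]
    have h1 := hylim.norm
    simp only [hnorm, norm_zero] at h1
    have h2 := tendsto_nhds_unique h1 tendsto_const_nhds
    rw [← norm_eq_zero, hnorm, h2]
  -- Split off the factor `l⁻¹` of the recurrence, then the factor `l`.
  have h1 (j : ℕ) : x (j + 1) - l * x j = 0 := by
    refine hgeom l⁻¹ (by rw [norm_inv, hl, inv_one]) (fun j => x (j + 1) - l * x j) ?_ ?_ j
    · intro j
      have h3 : l⁻¹ * l = 1 := inv_mul_cancel₀ hl0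
      linear_combination hx j + x j * h3
    · simpa using (hlim.comp (Filter.tendsto_add_atTop_nat 1)).sub (hlim.const_mul l)
  exact hgeom l hl x (fun j => sub_eq_zero.1 (h1 j)) hlim 0

theorem EllTwoZ.tendsto_cofinite_zero (G : EllTwoZ) :
    Filter.Tendsto (fun n => G n) Filter.cofinite (nhds 0) := by
  have h : Summable fun n : ℤ => ‖G n‖ ^ (2 : ℝ≥0∞).toReal :=
    (memℓp_gen_iff (by norm_num)).1 (lp.memℓp G)
  simp only [ENNReal.toReal_ofNat, Real.rpow_ofNat] at h
  have h1 := h.tendsto_cofinite_zero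
  rw [tendsto_zero_iff_norm_tendsto_zero]
  have h2 := h1.sqrt
  simpa [Real.sqrt_sq (norm_nonneg _)] using h2

theorem EllTwoZ.eq_zero_of_recurrence {l : ℂ} (hl : ‖l‖ = 1) (G : EllTwoZ) {q : ℤ} (hq : q ≠ 0)
    (m : ℤ) (h : ∀ j : ℕ, G (m + (j + 2) * q) + G (m + j * q) =
      (l + l⁻¹) * G (m + (j + 1) * q)) : G m = 0 := by
  have hinj : Function.Injective fun j : ℕ => m + (j : ℤ) * q := by
    intro i j hij
    simpa [hq] using hij
  have hlim := (G.tendsto_cofinite_zero.comp hinj.tendsto_cofinite)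
  rw [Nat.cofinite_eq_atTop] at hlim
  have := eq_zero_of_recurrence_of_tendsto_zero hl (fun j : ℕ => G (m + (j : ℤ) * q))
    (fun j => by simpa using h j) hlim
  simpa using this

namespace TwoSidedJacobi

open EllTwoZ Polynomial

variable {J : TwoSidedJacobi}

/-- If `J` satisfies the magic formula with the polynomial `D`, a resolvent vector
`G = (J - z)⁻¹ e₀` with `D(z) ∈ [-2, 2]` would satisfy `Gₙ₊ₚ + Gₙ₋ₚ = D(z) Gₙ` for `|n| ≥ p`, since
`(D(J) - D(z)) G` is a polynomial of degree below `p` in `J` applied to `e₀`. Square-summability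
then forces `G = 0`. -/
theorem mem_spectrum_of_aeval_mem_Icc {p : ℕ} (hp : 0 < p) {D : ℝ[X]}
    (hD : aeval J.op D = translation p + translation (-p)) {z : ℂ} {t : ℝ}
    (ht : t ∈ Set.Icc (-2 : ℝ) 2) (hz : aeval z D = t) : z ∈ spectrum ℂ J.op := by
  rw [spectrum.mem_iff]
  intro hunit
  obtain ⟨G, hG⟩ : ∃ G, (algebraMap ℂ (EllTwoZ →L[ℂ] EllTwoZ) z - J.op) G = basisVec 0 := by
    obtain ⟨R, hR⟩ := hunit.exists_right_inv
    exact ⟨R (basisVec 0), by rw [← mul_apply_eq_comp, hR, one_apply_eq_self]⟩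
  obtain ⟨l, hl0, -, hw⟩ := Complex.exists_add_inv_eq (t : ℂ)
  have hl := Complex.norm_eq_one_of_add_inv hl0 ht hw.symm
  have hdeg := (natDegree_and_leadingCoeff_of_magic hp hD).1
  obtain ⟨Q, hQ⟩ : X - C z ∣ D.map (algebraMap ℝ ℂ) - C (t : ℂ) := by
    rw [dvd_iff_isRoot, IsRoot, eval_sub, eval_C, eval_map_algebraMap, hz, sub_self]
  have hQd : Q.natDegree < p := by
    have h1 : (D.map (algebraMap ℝ ℂ) - C (t : ℂ)).natDegree = p := by
      rw [natDegree_sub_C, natDegree_map, hdeg]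
    have hQ0 : Q ≠ 0 := by
      rintro rfl
      rw [hQ, mul_zero, natDegree_zero] at h1
      omega
    rw [hQ, natDegree_mul (X_sub_C_ne_zero z) hQ0, natDegree_X_sub_C] at h1
    omega
  have hrec : translation p G + translation (-p) G - (t : ℂ) • G = aeval J.op (-Q) (basisVec 0) := by
    have h1 := congrArg (fun P : ℂ[X] => aeval J.op P G) hQ
    rw [mul_comm (X - C z)] at h1
    simp only [map_sub, map_mul, aeval_C, aeval_X, aeval_map_ofReal, hD, sub_apply, add_apply,
      mul_apply_eq_comp] at h1
    have h2 : (algebraMap ℂ (EllTwoZ →L[ℂ] EllTwoZ) (t : ℂ)) G = (t : ℂ) • G := by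
      rw [Algebra.algebraMap_eq_smul_one, smul_apply, one_apply_eq_self]
    rw [h2] at h1
    rw [h1, ← map_sub, ← sub_apply, ← neg_sub, neg_apply, hG, map_neg, map_neg, neg_apply]
  have hrec' (n : ℤ) (hn : (p : ℤ) ≤ |n|) : G (n - p) + G (n + p) = (l + l⁻¹) * G n := by
    have h1 := congrArg (fun v : EllTwoZ => v n) hrec
    have h0 := J.aeval_basisVec_zero_apply_of_lt (-Q) n (by rw [natDegree_neg]; omega)
    simp only [h0] at h1
    simp only [lp.coeFn_sub, lp.coeFn_add, lp.coeFn_smul, Pi.sub_apply, Pi.add_apply,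
      Pi.smul_apply, translation_apply, sub_neg_eq_add, smul_eq_mul] at h1
    rw [← hw]
    linear_combination h1
  have hG0 : G = 0 := by
    ext m
    have hp' : (p : ℤ) ≠ 0 := by omega
    rcases le_total 0 m with hm | hm
    · refine G.eq_zero_of_recurrence hl hp' m fun j => ?_
      have h2 : 0 ≤ (j : ℤ) * p := by positivity
      have h1 := hrec' (m + (j + 1) * p) (le_abs.2 (Or.inl (by linarith)))
      rw [show m + ((j : ℤ) + 2) * p = m + (j + 1) * p + p by ring,
        show m + (j : ℤ) * p = m + (j + 1) * p - p by ring, ← h1]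
      exact add_comm _ _
    · refine G.eq_zero_of_recurrence hl (neg_ne_zero.2 hp') m fun j => ?_
      have h2 : 0 ≤ (j : ℤ) * p := by positivity
      have h1 := hrec' (m + (j + 1) * (-p)) (le_abs.2 (Or.inr (by linarith)))
      rw [show m + ((j : ℤ) + 2) * (-p) = m + (j + 1) * (-p) - p by ring,
        show m + (j : ℤ) * (-p) = m + (j + 1) * (-p) + p by ring, h1]
  rw [hG0, map_zero] at hG
  have := congrArg (fun v : EllTwoZ => v 0) hG
  simp [basisVec_apply] at this

/-- The magic formula with a polynomial `D` determines the spectrum as the preimage of `[-2, 2]`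
under `D`. -/
theorem mem_spectrum_iff_of_magic {p : ℕ} (hp : 0 < p) {D : ℝ[X]}
    (hD : aeval J.op D = translation p + translation (-p)) (z : ℂ) :
    z ∈ spectrum ℂ J.op ↔ ∃ t ∈ Set.Icc (-2 : ℝ) 2, aeval z D = t := by
  constructor
  · intro hz
    have h := spectrum.subset_polynomial_aeval J.op (D.map (algebraMap ℝ ℂ)) ⟨z, hz, rfl⟩
    rw [aeval_map_ofReal, hD] at h
    simp only [eval_map_algebraMap] at h
    exact mem_Icc_of_mem_spectrum_translation_add h
  · rintro ⟨t, ht, hz⟩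
    exact mem_spectrum_of_aeval_mem_Icc hp hD ht hz

end TwoSidedJacobi

end

theorem theorem2p1 (p : ℕ) (hp : 0 < p) (J₀ : TwoSidedJacobi) (hJ₀ : J₀.IsPeriodic p)
    (J : TwoSidedJacobi) :
    (Polynomial.aeval J.op (J₀.discriminant p) =
        ((rightShift ^ p : (EllTwoZ →L[ℂ] EllTwoZ)ˣ) : EllTwoZ →L[ℂ] EllTwoZ) +
        ((rightShift ^ (-(p : ℤ)) : (EllTwoZ →L[ℂ] EllTwoZ)ˣ) : EllTwoZ →L[ℂ] EllTwoZ) ↔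
      J ∈ J₀.isospectralTorus p) ∧
    (Polynomial.aeval J.op (J₀.discriminant p) =
        ((rightShift ^ p : (EllTwoZ →L[ℂ] EllTwoZ)ˣ) : EllTwoZ →L[ℂ] EllTwoZ) +
        ((rightShift ^ (-(p : ℤ)) : (EllTwoZ →L[ℂ] EllTwoZ)ˣ) : EllTwoZ →L[ℂ] EllTwoZ) →
      J.IsPeriodic p) := by
  rw [rightShift_pow_val, rightShift_zpow_neg_val]
  have hmagic₀ := hJ₀.aeval_discriminant
  have hper (h : Polynomial.aeval J.op (J₀.discriminant p) = translation p + translation (-p)) :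
      J.IsPeriodic p := by
    refine TwoSidedJacobi.isPeriodic_of_commute hp ?_
    rw [← h]
    have hc := (Commute.all Polynomial.X (J₀.discriminant p)).map (Polynomial.aeval J.op)
    rwa [Polynomial.aeval_X] at hc
  refine ⟨⟨fun h => ⟨hper h, ?_⟩, fun h => ?_⟩, hper⟩
  · ext z
    rw [TwoSidedJacobi.mem_spectrum_iff_of_magic hp h,
      TwoSidedJacobi.mem_spectrum_iff_of_magic hp hmagic₀]
  · obtain ⟨hJ, hspec⟩ := h
    have hmagic := hJ.aeval_discriminant
    obtain ⟨hd, hl⟩ := TwoSidedJacobi.natDegree_and_leadingCoeff_of_magic hp hmagic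
    obtain ⟨hd₀, hl₀⟩ := TwoSidedJacobi.natDegree_and_leadingCoeff_of_magic hp hmagic₀
    rw [Polynomial.eq_of_preimage_Icc_eq (J₀.discriminant p) (J.discriminant p) (by omega)
      (by omega) hl₀ hl fun z => ?_]
    · exact hmagic
    · rw [← TwoSidedJacobi.mem_spectrum_iff_of_magic hp hmagic,
        ← TwoSidedJacobi.mem_spectrum_iff_of_magic hp hmagic₀, hspec]
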